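/- For an $n\times n$ complex matrix $A_n$, write $a_{k;j}(n)$ for the $j$-th entry ($0\le j\le n-|k|-1$) of its $k$-th diagonal, i.e. the entry in row $j+\max(-k,0)$ and column $j+\max(k,0)$ (rows and columns numbered from $0$), and set $a_{k;j}(n)=0$ when there is no such entry. For $0\le j<n$ let $$\boldsymbol a_j(n)=(\dots,0,a_{-j;j}(n),a_{-j+1;j}(n),\dots,a_{n-j;j}(n),0,\dots)\in \ell^1(\mathbb Z),$$ where $a_{k;j}(n)$ stands at position $k$. Let $\{A_n\}_{n\ge 1}$ be a sequence of complex matrices, $A_n$ of size $n\times n$, such that $$\mathcal M:=\sup_n\ \sum_{|k|\le n}\max_{j}|a_{k;j}(n)|<\infty ,$$ and let $D_{\mathcal M}=\{z\in\mathbb C:|z|\le\mathcal M\}$. Suppose that there is $\boldsymbol a=\{a_k\}_{k\in\mathbb Z}\in\ell^1(\mathbb Z)$ such that for every $\varepsilon>0$ $$\#\{0\le j<n:\ \|\boldsymbol a_j(n)-\boldsymbol a\|_{\ell^1}>\varepsilon\}=o(n)\qquad(n\to\infty),$$ and put $a(t)=\sum_{k\in\mathbb Z}a_ke^{ikt}$.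 Let $\lambda_1(A_n),\dots,\lambda_n(A_n)$ be the eigenvalues of $A_n$, counted with algebraic multiplicity. Then all $\lambda_k(A_n)$ and all values $a(t)$, $t\in\mathbb R$, lie in $D_{\mathcal M}$, and $$\lim_{n\to\infty}\frac1n\sum_{k=1}^n\varphi(\lambda_k(A_n))=\frac1{2\pi}\int_{-\pi}^{\pi}\varphi(a(t))\,dt$$ for every complex function $\varphi$ that is continuous on $D_{\mathcal M}$ and analytic in its interior (in particular, for every $\varphi$ analytic on $D_{\mathcal M}$). If all $A_n$ are Hermitian, then $a(t)$ is real for all $t$ and the same limit relation holds for every continuous $\varphi:[-\mathcal M,\mathcal M]\to\mathbb C$. -/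

import Mathlib

/-- The entry `a_{k;j}` of an `n × n` matrix in diagonal numbering: the `j`-th entry (counted from
`0`) of the `k`-th diagonal, where `k = 0` is the main diagonal and `k > 0` are the upper diagonals.
It sits in row `j + max (-k) 0` and column `j + max k 0` (both counted from `0`), and it is `0` by
convention if there is no such position in the matrix. -/
noncomputable def diagEntry {n : ℕ} (A : Matrix (Fin n) (Fin n) ℂ) (k : ℤ) (j : ℕ) : ℂ :=
  if h : j + (-k).toNat < n ∧ j + k.toNat < n then
    A ⟨j + (-k).toNat, h.1⟩ ⟨j + k.toNat, h.2⟩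
  else 0

/-- The two-sided sequence `(…, 0, a_{-j;j}, a_{-j+1;j}, …, a_{n-j;j}, 0, …)`. -/
noncomputable def diagSeq {n : ℕ} (A : Matrix (Fin n) (Fin n) ℂ) (j : ℕ) (k : ℤ) : ℂ :=
  if -(j : ℤ) ≤ k ∧ k ≤ (n : ℤ) - j then diagEntry A k j else 0

theorem memlp_diagSeq {n : ℕ} (A : Matrix (Fin n) (Fin n) ℂ) (j : ℕ) :
    Memℓp (diagSeq A j) 1 := by
  refine (memℓp_zero ?_).of_exponent_ge zero_le
  refine (Set.finite_Icc (-(j : ℤ)) ((n : ℤ) - j)).subset ?_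
  intro k hk
  by_contra hc
  exact hk (if_neg hc)

/-- The diagonal vector `𝐚_j(n)` of an `n × n` matrix, as an element of `ℓ¹(ℤ)`. -/
noncomputable def diagVec {n : ℕ} (A : Matrix (Fin n) (Fin n) ℂ) (j : ℕ) :
    lp (fun _ : ℤ => ℂ) 1 :=
  ⟨diagSeq A j, memlp_diagSeq A j⟩

/-- `∑_{|k| ≤ n} max_j |a_{k;j}|`, the maximum over an empty diagonal being `0`. -/
noncomputable def diagMaxSum {n : ℕ} (A : Matrix (Fin n) (Fin n) ℂ) : ℝ :=
  ∑ k ∈ Finset.Icc (-(n : ℤ)) n, (((Finset.range n).sup fun j => ‖diagEntry A k j‖₊ : NNReal) : ℝ)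

/-- The constant `sup_n ∑_{|k| ≤ n} max_j |a_{k;j}(n)|` (meaningful when these sums are bounded). -/
noncomputable def diagBound (A : (n : ℕ) → Matrix (Fin n) (Fin n) ℂ) : ℝ :=
  ⨆ n, diagMaxSum (A n)

/-- The function `a(t) = ∑_{k ∈ ℤ} a_k e^{ikt}` for `a ∈ ℓ¹(ℤ)`. -/
noncomputable def fourierSymbol (a : lp (fun _ : ℤ => ℂ) 1) (t : ℝ) : ℂ :=
  ∑' k : ℤ, a k * Complex.exp (Complex.I * k * t)

/-! The proof is the method of moments. Power sums of eigenvalues are traces of powers, so the core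
is tr A_n^(p+1) = (n/2π) ∫ a^(p+1) + o(n), used in `tendsto_mean_pow_roots`. Eigenvalues (by
Gershgorin) and symbol values stay in D_M. Polynomials are uniformly dense in the disk algebra, and
in the continuous functions on the real segment, so the moments decide every admissible φ
(`tendsto_mean_of_tendsto_pow`).

The vectors a_j(n) do not see entries with k < -j, so A_n need not be close to the Toeplitz matrix
(a_{j-i}) in the entrywise ℓ¹ norm. The trace does not see the troublesome entries either. Deleting
the diagonals k > r changes the trace of a power by O(δn) + o(n). Afterwards each step of a closed
walk raises the index by at most r, so among p+1 steps none can lower it by more than pr, and the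
diagonals k < -(p+1)r can be deleted at no cost (`Matrix.trace_pow_eq_of_band`).

The remaining band matrix C is ℓ¹-close to Toeplitz, so e_t = (e^{ijt})_j is an approximate
eigenvector with eigenvalue a(t), uniformly in t. Averaging ⟨C^(p+1) e_t, e_t⟩ over t gives exactly
the trace, hence the moment of a (`norm_trace_pow_sub_integral_le`). -/

/-! ### Eigenvalues with multiplicity and traces of powers. -/

theorem Matrix.card_roots_charpoly {n : ℕ} (A : Matrix (Fin n) (Fin n) ℂ) :
    Multiset.card A.charpoly.roots = n := by
  rw [← (IsAlgClosed.splits A.charpoly).natDegree_eq_card_roots,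
    Matrix.charpoly_natDegree_eq_dim, Fintype.card_fin]

open Polynomial in
theorem Matrix.det_aeval_eq_prod_roots_charpoly {n : ℕ} (A : Matrix (Fin n) (Fin n) ℂ)
    (q : ℂ[X]) : (aeval A q).det = (A.charpoly.roots.map fun z => q.eval z).prod := by
  have hlin (w : ℂ) : (aeval A (X - C w)).det
      = (A.charpoly.roots.map fun z => (X - C w).eval z).prod := by
    have h1 : (aeval A (X - C w)) = -(Matrix.scalar (Fin n) w - A) := by
      simp [Matrix.algebraMap_eq_diagonal, Pi.algebraMap_def, Matrix.scalar]
    have hroots : A.charpoly = (A.charpoly.roots.map fun z => X - C z).prod :=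
      (IsAlgClosed.splits A.charpoly).eq_prod_roots_of_monic A.charpoly_monic
    rw [h1, Matrix.det_neg, ← Matrix.eval_charpoly, hroots, eval_multiset_prod, Multiset.map_map,
      ← hroots, Fintype.card_fin]
    have : (fun z => (X - C w).eval z) = fun z => (-1) * (eval w ∘ fun z => X - C z) z := by
      funext z; simp
    rw [this, Multiset.prod_map_mul]
    simp [A.card_roots_charpoly]
  have hs (s : Multiset ℂ) : (aeval A (s.map fun w => X - C w).prod).det
      = (A.charpoly.roots.map fun z => ((s.map fun w => X - C w).prod).eval z).prod := by
    induction s using Multiset.induction_on with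
    | empty => simp
    | cons w s ih =>
      simp only [Multiset.map_cons, Multiset.prod_cons, map_mul, Matrix.det_mul, eval_mul,
        Multiset.prod_map_mul]
      rw [ih, hlin]
  rw [(IsAlgClosed.splits q).eq_prod_roots]
  simp only [map_mul, Matrix.det_mul, eval_mul, Multiset.prod_map_mul, hs]
  simp [A.card_roots_charpoly, Matrix.algebraMap_eq_diagonal, Pi.algebraMap_def]

open Polynomial in
theorem Matrix.roots_charpoly_pow {n : ℕ} (A : Matrix (Fin n) (Fin n) ℂ) (p : ℕ) :
    (A ^ p).charpoly.roots = A.charpoly.roots.map (· ^ p) := by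
  have : (A ^ p).charpoly = ((A.charpoly.roots.map (· ^ p)).map fun z => X - C z).prod := by
    refine Polynomial.funext fun w => ?_
    -- For this polynomial the determinant is the characteristic polynomial of `A ^ p` at `w`.
    have h := A.det_aeval_eq_prod_roots_charpoly (C w - X ^ p)
    rw [Matrix.eval_charpoly, eval_multiset_prod, Multiset.map_map, Multiset.map_map]
    have h1 : (aeval A (C w - X ^ p)) = Matrix.scalar (Fin n) w - A ^ p := by
      simp [Matrix.algebraMap_eq_diagonal, Pi.algebraMap_def, Matrix.scalar]
    rw [← h1, h]
    simp [Function.comp_def]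
  rw [this, roots_multiset_prod_X_sub_C]

theorem Matrix.trace_pow_eq_sum_roots_charpoly {n : ℕ} (A : Matrix (Fin n) (Fin n) ℂ) (p : ℕ) :
    (A ^ p).trace = (A.charpoly.roots.map (· ^ p)).sum := by
  rw [Matrix.trace_eq_sum_roots_charpoly, Matrix.roots_charpoly_pow]

/-- Gershgorin: z lies within the off-diagonal row sum of some diagonal entry. -/
theorem Matrix.norm_le_of_mem_roots_charpoly {n : ℕ} {A : Matrix (Fin n) (Fin n) ℂ} {M : ℝ}
    (hA : ∀ i, ∑ j, ‖A i j‖ ≤ M) {z : ℂ} (hz : z ∈ A.charpoly.roots) : ‖z‖ ≤ M := by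
  have h1 : z ∈ spectrum ℂ A :=
    Matrix.mem_spectrum_of_isRoot_charpoly (Polynomial.isRoot_of_mem_roots hz)
  rw [← Matrix.spectrum_toLin', ← Module.End.hasEigenvalue_iff_mem_spectrum] at h1
  obtain ⟨k, hk⟩ := eigenvalue_mem_ball h1
  have h2 := hA k
  rw [← Finset.add_sum_erase _ _ (Finset.mem_univ k)] at h2
  rw [mem_closedBall_iff_norm] at hk
  linarith [norm_sub_norm_le z (A k k)]

/-! ### Entrywise ℓ¹ estimates for powers. -/

section EntrySums

variable {n : ℕ} {A B X Y : Matrix (Fin n) (Fin n) ℂ} {M : ℝ}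

theorem Matrix.sum_col_norm_mul_le (hX : ∀ j, ∑ i, ‖X i j‖ ≤ M) (v : Fin n → ℂ) :
    ∑ i, ‖(X.mulVec v) i‖ ≤ M * ∑ j, ‖v j‖ := by
  calc ∑ i, ‖(X.mulVec v) i‖ ≤ ∑ i, ∑ j, ‖X i j‖ * ‖v j‖ := by
        refine Finset.sum_le_sum fun i _ => ?_
        refine (norm_sum_le Finset.univ fun j => X i j * v j).trans_eq ?_
        simp
    _ = ∑ j, (∑ i, ‖X i j‖) * ‖v j‖ := by
        rw [Finset.sum_comm]; simp only [Finset.sum_mul]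
    _ ≤ ∑ j, M * ‖v j‖ := by
        gcongr with j
        exact hX j
    _ = _ := by rw [Finset.mul_sum]

theorem Matrix.sum_norm_mul_le_of_col (hX : ∀ j, ∑ i, ‖X i j‖ ≤ M) :
    ∑ i, ∑ j, ‖(X * Y) i j‖ ≤ M * ∑ i, ∑ j, ‖Y i j‖ := by
  rw [Finset.sum_comm, Finset.sum_comm (f := fun i j : Fin n => ‖Y i j‖), Finset.mul_sum]
  exact Finset.sum_le_sum fun j _ => Matrix.sum_col_norm_mul_le hX fun i => Y i j

theorem Matrix.sum_norm_mul_le_of_row (hY : ∀ i, ∑ j, ‖Y i j‖ ≤ M) :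
    ∑ i, ∑ j, ‖(X * Y) i j‖ ≤ M * ∑ i, ∑ j, ‖X i j‖ := by
  have h := Matrix.sum_norm_mul_le_of_col (X := Y.transpose) (Y := X.transpose) (M := M) hY
  rw [← Matrix.transpose_mul, Finset.sum_comm,
    Finset.sum_comm (f := fun i j : Fin n => ‖X.transpose i j‖)] at h
  exact h

theorem Matrix.sum_norm_pow_mul_le (hX : ∀ j, ∑ i, ‖X i j‖ ≤ M) (hM : 0 ≤ M) (p : ℕ) :
    ∑ i, ∑ j, ‖(X ^ p * Y) i j‖ ≤ M ^ p * ∑ i, ∑ j, ‖Y i j‖ := by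
  induction p with
  | zero => simp
  | succ p ih =>
    rw [pow_succ', mul_assoc, pow_succ', mul_assoc]
    exact (Matrix.sum_norm_mul_le_of_col hX).trans (by gcongr)

/-- Telescoping into A^i (A - B) B^j: left factors are controlled by column sums, right factors by
row sums. -/
theorem Matrix.sum_norm_pow_sub_pow_le (hM : 0 ≤ M) (hA : ∀ j, ∑ i, ‖A i j‖ ≤ M)
    (hB : ∀ i, ∑ j, ‖B i j‖ ≤ M) (p : ℕ) :
    ∑ i, ∑ j, ‖(A ^ (p + 1) - B ^ (p + 1)) i j‖
      ≤ (p + 1) * M ^ p * ∑ i, ∑ j, ‖(A - B) i j‖ := by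
  induction p with
  | zero => simp
  | succ p ih =>
    have h : A ^ (p + 1 + 1) - B ^ (p + 1 + 1)
        = A ^ (p + 1) * (A - B) + (A ^ (p + 1) - B ^ (p + 1)) * B := by
      rw [pow_succ A (p + 1), pow_succ B (p + 1)]; noncomm_ring
    have h1 := Matrix.sum_norm_pow_mul_le (Y := A - B) hA hM (p + 1)
    have h2 := Matrix.sum_norm_mul_le_of_row (X := A ^ (p + 1) - B ^ (p + 1)) hB
    have h3 := mul_le_mul_of_nonneg_left ih hM
    have h4 : ∑ i, ∑ j, ‖(A ^ (p + 1 + 1) - B ^ (p + 1 + 1)) i j‖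
        ≤ ∑ i, ∑ j, ‖(A ^ (p + 1) * (A - B)) i j‖
          + ∑ i, ∑ j, ‖((A ^ (p + 1) - B ^ (p + 1)) * B) i j‖ := by
      simp only [h, ← Finset.sum_add_distrib]
      exact Finset.sum_le_sum fun i _ => Finset.sum_le_sum fun j _ => norm_add_le _ _
    push_cast
    calc _ ≤ _ := h4
      _ ≤ M ^ (p + 1) * (∑ i, ∑ j, ‖(A - B) i j‖)
          + M * ((p + 1) * M ^ p * ∑ i, ∑ j, ‖(A - B) i j‖) := add_le_add h1 (h2.trans h3)
      _ = _ := by ring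

theorem Matrix.norm_trace_le_sum_norm : ‖X.trace‖ ≤ ∑ i, ∑ j, ‖X i j‖ :=
  (norm_sum_le _ _).trans <| Finset.sum_le_sum fun i _ =>
    Finset.single_le_sum (f := fun j => ‖X i j‖) (fun _ _ => norm_nonneg _) (Finset.mem_univ i)

theorem Matrix.norm_trace_pow_sub_le (hM : 0 ≤ M) (hA : ∀ j, ∑ i, ‖A i j‖ ≤ M)
    (hB : ∀ i, ∑ j, ‖B i j‖ ≤ M) (p : ℕ) :
    ‖(A ^ (p + 1)).trace - (B ^ (p + 1)).trace‖
      ≤ (p + 1) * M ^ p * ∑ i, ∑ j, ‖(A - B) i j‖ := by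
  rw [← Matrix.trace_sub]
  exact Matrix.norm_trace_le_sum_norm.trans (Matrix.sum_norm_pow_sub_pow_le hM hA hB p)

/-- Applying powers to an approximate eigenvector, measured in `ℓ¹`. -/
theorem Matrix.sum_norm_pow_mulVec_sub_le (hM : 0 ≤ M) (hA : ∀ j, ∑ i, ‖A i j‖ ≤ M) (v : Fin n → ℂ)
    {c : ℂ} (hc : ‖c‖ ≤ M) (p : ℕ) :
    ∑ i, ‖((A ^ (p + 1)).mulVec v) i - c ^ (p + 1) * v i‖
      ≤ (p + 1) * M ^ p * ∑ i, ‖(A.mulVec v) i - c * v i‖ := by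
  induction p with
  | zero => simp
  | succ p ih =>
    have h (i : Fin n) : ((A ^ (p + 1 + 1)).mulVec v) i - c ^ (p + 1 + 1) * v i
        = (A.mulVec fun i => ((A ^ (p + 1)).mulVec v) i - c ^ (p + 1) * v i) i
          + c ^ (p + 1) * ((A.mulVec v) i - c * v i) := by
      have : (fun i => ((A ^ (p + 1)).mulVec v) i - c ^ (p + 1) * v i)
          = (A ^ (p + 1)).mulVec v - c ^ (p + 1) • v := by
        ext i; simp
      rw [this, Matrix.mulVec_sub, Matrix.mulVec_mulVec, Matrix.mulVec_smul, ← pow_succ']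
      simp only [Pi.sub_apply, Pi.smul_apply, smul_eq_mul]
      ring
    have h1 := Matrix.sum_col_norm_mul_le hA
      fun i => ((A ^ (p + 1)).mulVec v) i - c ^ (p + 1) * v i
    have h2 : ∑ i, ‖c ^ (p + 1) * ((A.mulVec v) i - c * v i)‖
        ≤ M ^ (p + 1) * ∑ i, ‖(A.mulVec v) i - c * v i‖ := by
      simp only [norm_mul, norm_pow, ← Finset.mul_sum]
      gcongr
    have h3 := mul_le_mul_of_nonneg_left ih hM
    push_cast
    calc _ ≤ _ := Finset.sum_le_sum fun i _ => (congrArg norm (h i)).le.trans (norm_add_le _ _)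
      _ ≤ M * ((p + 1) * M ^ p * ∑ i, ‖(A.mulVec v) i - c * v i‖)
          + M ^ (p + 1) * ∑ i, ‖(A.mulVec v) i - c * v i‖ := by
        rw [Finset.sum_add_distrib]
        exact add_le_add (h1.trans h3) h2
      _ = _ := by ring

end EntrySums

/-! ### Bandwidth and closed walks. -/

section Bands

variable {n : ℕ} {A B X Y : Matrix (Fin n) (Fin n) ℂ}

theorem Matrix.mul_apply_eq_zero_of_band {r s : ℤ}
    (hX : ∀ i j : Fin n, r < (j : ℤ) - i → X i j = 0)
    (hY : ∀ i j : Fin n, s < (j : ℤ) - i → Y i j = 0) (i j : Fin n) (h : r + s < (j : ℤ) - i) :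
    (X * Y) i j = 0 := by
  rw [Matrix.mul_apply]
  refine Finset.sum_eq_zero fun k _ => ?_
  by_cases hk : r < (k : ℤ) - i
  · rw [hX i k hk, zero_mul]
  · rw [hY k j (by omega), mul_zero]

theorem Matrix.pow_apply_eq_zero_of_band {r : ℤ}
    (hX : ∀ i j : Fin n, r < (j : ℤ) - i → X i j = 0) (p : ℕ) (i j : Fin n)
    (h : p * r < (j : ℤ) - i) : (X ^ p) i j = 0 := by
  induction p generalizing i j with
  | zero =>
    rw [pow_zero, Matrix.one_apply_ne]
    rintro rfl
    simp at h
  | succ p ih =>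
    rw [pow_succ]
    refine Matrix.mul_apply_eq_zero_of_band (r := p * r) ih hX i j ?_
    push_cast at h
    linarith

/-- A perturbation far below the diagonal does not change the trace of powers of a matrix with
small upper bandwidth. -/
theorem Matrix.trace_pow_eq_of_band {r K : ℤ} (p : ℕ) (hK : p * r ≤ K)
    (hA : ∀ i j : Fin n, r < (j : ℤ) - i → A i j = 0)
    (hB : ∀ i j : Fin n, r < (j : ℤ) - i → B i j = 0)
    (hAB : ∀ i j : Fin n, -K ≤ (j : ℤ) - i → A i j = B i j) :
    (A ^ (p + 1)).trace = (B ^ (p + 1)).trace := by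
  -- `A - B` lives on diagonals at most -(K+1), and each further factor raises this bound by at most
  -- r. At q = p the bound is still negative, so the main diagonal vanishes.
  have key (q : ℕ) : ∀ i j : Fin n, -(K + 1) + q * r < (j : ℤ) - i →
      (A ^ (q + 1) - B ^ (q + 1)) i j = 0 := by
    induction q with
    | zero =>
      intro i j h
      simp only [zero_add, pow_one, Matrix.sub_apply, sub_eq_zero]
      exact hAB i j (by simp at h; omega)
    | succ q ih =>
      intro i j h
      have h1 : A ^ (q + 1 + 1) - B ^ (q + 1 + 1)
          = (A ^ (q + 1) - B ^ (q + 1)) * A + B ^ (q + 1) * (A - B) := by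
        rw [pow_succ A (q + 1), pow_succ B (q + 1)]; noncomm_ring
      push_cast at h
      rw [h1, Matrix.add_apply,
        Matrix.mul_apply_eq_zero_of_band ih hA i j (by linarith),
        Matrix.mul_apply_eq_zero_of_band (r := (q + 1 : ℕ) * r) (s := -(K + 1))
          (Matrix.pow_apply_eq_zero_of_band hB (q + 1))
          (fun i j h => by
            rw [Matrix.sub_apply, sub_eq_zero]
            exact hAB i j (by omega)) i j (by push_cast; linarith), add_zero]
  rw [← sub_eq_zero, ← Matrix.trace_sub]
  exact Finset.sum_eq_zero fun i _ => key p i i (by simp; linarith)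

end Bands

/-! ### Tails of the coefficient sequence. -/

theorem lp_one_hasSum_norm (a : lp (fun _ : ℤ => ℂ) 1) : HasSum (fun k => ‖a k‖) ‖a‖ := by
  have h := lp.hasSum_norm (p := 1) (by simp) a
  simpa using h

/-- The modulus of the `k`-th coefficient if `|k| > r`, and `0` otherwise. -/
noncomputable def coeffTail (a : lp (fun _ : ℤ => ℂ) 1) (r : ℕ) (k : ℤ) : ℝ :=
  if k ∈ Finset.Icc (-(r : ℤ)) r then 0 else ‖a k‖

theorem coeffTail_nonneg (a : lp (fun _ : ℤ => ℂ) 1) (r : ℕ) (k : ℤ) : 0 ≤ coeffTail a r k := by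
  unfold coeffTail; split_ifs <;> positivity

theorem coeffTail_le (a : lp (fun _ : ℤ => ℂ) 1) (r : ℕ) (k : ℤ) : coeffTail a r k ≤ ‖a k‖ := by
  unfold coeffTail; split_ifs <;> simp

theorem summable_coeffTail (a : lp (fun _ : ℤ => ℂ) 1) (r : ℕ) : Summable (coeffTail a r) :=
  (lp_one_hasSum_norm a).summable.of_nonneg_of_le (coeffTail_nonneg a r) (coeffTail_le a r)

theorem exists_tsum_coeffTail_le (a : lp (fun _ : ℤ => ℂ) 1) {δ : ℝ} (hδ : 0 < δ) :
    ∃ r : ℕ, ∑' k, coeffTail a r k ≤ δ := by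
  obtain ⟨s, hs⟩ := Filter.eventually_atTop.1
    ((lp_one_hasSum_norm a).eventually (lt_mem_nhds (sub_lt_self ‖a‖ hδ)))
  refine ⟨s.sup Int.natAbs, ?_⟩
  have h1 := hs (Finset.Icc (-((s.sup Int.natAbs : ℕ) : ℤ)) (s.sup Int.natAbs : ℕ)) (by
    intro k hk
    have := Finset.le_sup (f := Int.natAbs) hk
    rw [Finset.mem_Icc]; omega)
  have h2 := (lp_one_hasSum_norm a).sub (hasSum_sum_of_ne_finset_zero
    (f := fun k => if k ∈ Finset.Icc (-((s.sup Int.natAbs : ℕ) : ℤ)) (s.sup Int.natAbs : ℕ)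
      then ‖a k‖ else 0) fun k hk => if_neg hk)
  have h3 : coeffTail a (s.sup Int.natAbs) = fun k => ‖a k‖ -
      if k ∈ Finset.Icc (-((s.sup Int.natAbs : ℕ) : ℤ)) (s.sup Int.natAbs : ℕ)
      then ‖a k‖ else 0 := by
    funext k; unfold coeffTail; split_ifs <;> simp
  rw [h3, h2.tsum_eq, Finset.sum_congr rfl fun k hk => if_pos hk]
  linarith

/-! ### The symbol and exponentials as approximate eigenvectors. -/

section Symbol

variable (a : lp (fun _ : ℤ => ℂ) 1)

theorem norm_exp_I_mul_int_mul (k : ℤ) (t : ℝ) : ‖Complex.exp (Complex.I * k * t)‖ = 1 := by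
  have : Complex.I * k * t = ((k * t : ℝ) : ℂ) * Complex.I := by push_cast; ring
  rw [this, Complex.norm_exp_ofReal_mul_I]

theorem summable_fourierSymbol (t : ℝ) :
    Summable fun k : ℤ => a k * Complex.exp (Complex.I * k * t) :=
  .of_norm (by simpa [norm_exp_I_mul_int_mul] using (lp_one_hasSum_norm a).summable)

theorem norm_fourierSymbol_le (t : ℝ) : ‖fourierSymbol a t‖ ≤ ‖a‖ := by
  refine tsum_of_norm_bounded (lp_one_hasSum_norm a) fun k => ?_
  simp [norm_exp_I_mul_int_mul]

theorem continuous_fourierSymbol : Continuous (fourierSymbol a) := by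
  refine continuous_tsum (fun k => by fun_prop) (lp_one_hasSum_norm a).summable fun k t => ?_
  simp [norm_exp_I_mul_int_mul]

theorem fourierSymbol_im_eq_zero (ha : ∀ k, a (-k) = star (a k)) (t : ℝ) :
    (fourierSymbol a t).im = 0 := by
  rw [← Complex.conj_eq_iff_im, fourierSymbol, Complex.conj_tsum,
    ← (Equiv.neg ℤ).tsum_eq fun k : ℤ => a k * Complex.exp (Complex.I * k * t)]
  refine tsum_congr fun k => ?_
  rw [Equiv.neg_apply, ha, map_mul, ← Complex.exp_conj]
  simp

/-- The vector `(e^{ijt})_j`. -/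
noncomputable def expVec (n : ℕ) (t : ℝ) (j : Fin n) : ℂ :=
  Complex.exp (Complex.I * ((j : ℕ) : ℤ) * t)

theorem norm_expVec {n : ℕ} (t : ℝ) (j : Fin n) : ‖expVec n t j‖ = 1 :=
  norm_exp_I_mul_int_mul _ _

theorem integral_exp_I_mul_int (k : ℤ) :
    ∫ t in (-Real.pi)..Real.pi, Complex.exp (Complex.I * k * t)
      = if k = 0 then 2 * (Real.pi : ℂ) else 0 := by
  split_ifs with hk
  · subst hk
    simp
    ring
  · rw [integral_exp_mul_complex (by simpa using hk)]
    have : Complex.exp (Complex.I * k * Real.pi)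
        = Complex.exp (Complex.I * k * ((-Real.pi : ℝ) : ℂ)) := by
      rw [Complex.exp_eq_exp_iff_exists_int]
      exact ⟨k, by push_cast; ring⟩
    rw [this, sub_self, zero_div]

/-- Orthogonality of the exponentials: only the diagonal entries survive averaging over t. -/
theorem integral_sum_mulVec_expVec {n : ℕ} (X : Matrix (Fin n) (Fin n) ℂ) :
    ∫ t in (-Real.pi)..Real.pi, ∑ i, (X.mulVec (expVec n t)) i * star (expVec n t i)
      = 2 * Real.pi * X.trace := by
  have h (t : ℝ) : ∑ i, (X.mulVec (expVec n t)) i * star (expVec n t i)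
      = ∑ i, ∑ j, X i j *
        Complex.exp (Complex.I * (((j : ℕ) : ℤ) - ((i : ℕ) : ℤ) : ℤ) * t) := by
    refine Finset.sum_congr rfl fun i _ => ?_
    rw [Matrix.mulVec, dotProduct, Finset.sum_mul]
    refine Finset.sum_congr rfl fun j _ => ?_
    have : star (expVec n t i) = Complex.exp (-(Complex.I * ((i : ℕ) : ℤ) * t)) := by
      rw [expVec, Complex.star_def, ← Complex.exp_conj]
      simp
    rw [this, expVec, mul_assoc, ← Complex.exp_add]
    congr 2
    push_cast
    ring
  simp only [h]
  rw [intervalIntegral.integral_finsetSum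
    fun i _ => Continuous.intervalIntegrable (by fun_prop) _ _, Matrix.trace, Finset.mul_sum]
  refine Finset.sum_congr rfl fun i _ => ?_
  rw [intervalIntegral.integral_finsetSum
    fun j _ => Continuous.intervalIntegrable (by fun_prop) _ _]
  simp only [intervalIntegral.integral_const_mul, integral_exp_I_mul_int]
  rw [Finset.sum_eq_single i]
  · simp [mul_comm]
  · intro j _ hj
    rw [if_neg, mul_zero]
    rw [sub_eq_zero]
    exact fun h => hj (Fin.ext (by exact_mod_cast h))
  · simp

/-- The entries of e_t are unimodular, so pairing the residual of the power with e_t costs no more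
than its ℓ¹ norm, and ⟨e_t, e_t⟩ = n yields the main term. -/
theorem norm_trace_pow_sub_integral_le {n : ℕ} {A : Matrix (Fin n) (Fin n) ℂ} {M η : ℝ}
    (hM : 0 ≤ M) (hA : ∀ j, ∑ i, ‖A i j‖ ≤ M) (ha : ‖a‖ ≤ M)
    (hη : ∀ t, ∑ i, ‖(A.mulVec (expVec n t)) i - fourierSymbol a t * expVec n t i‖ ≤ η) (p : ℕ) :
    ‖(A ^ (p + 1)).trace - n * (1 / (2 * (Real.pi : ℂ)) *
      ∫ t in (-Real.pi)..Real.pi, fourierSymbol a t ^ (p + 1))‖ ≤ (p + 1) * M ^ p * η := by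
  have hpi : (2 * (Real.pi : ℂ)) ≠ 0 := by simp [Real.pi_ne_zero]
  have hcont := continuous_fourierSymbol a
  have hexp (j : Fin n) : Continuous fun t => expVec n t j := by unfold expVec; fun_prop
  have hc1 : Continuous fun t =>
      ∑ i, ((A ^ (p + 1)).mulVec (expVec n t)) i * star (expVec n t i) := by
    unfold Matrix.mulVec dotProduct
    fun_prop
  have h1 : (A ^ (p + 1)).trace - n * (1 / (2 * (Real.pi : ℂ)) *
      ∫ t in (-Real.pi)..Real.pi, fourierSymbol a t ^ (p + 1))
      = 1 / (2 * (Real.pi : ℂ)) * ∫ t in (-Real.pi)..Real.pi,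
        ∑ i, (((A ^ (p + 1)).mulVec (expVec n t)) i - fourierSymbol a t ^ (p + 1) * expVec n t i)
          * star (expVec n t i) := by
    have h2 (t : ℝ) : ∑ i, (((A ^ (p + 1)).mulVec (expVec n t)) i
          - fourierSymbol a t ^ (p + 1) * expVec n t i) * star (expVec n t i)
        = ∑ i, ((A ^ (p + 1)).mulVec (expVec n t)) i * star (expVec n t i)
          - n * fourierSymbol a t ^ (p + 1) := by
      have h3 (i : Fin n) : expVec n t i * star (expVec n t i) = 1 := by
        rw [Complex.star_def, Complex.mul_conj, Complex.normSq_eq_norm_sq, norm_expVec]; simp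
      simp only [sub_mul, mul_assoc, h3, Finset.sum_sub_distrib]
      simp
    simp only [h2]
    rw [intervalIntegral.integral_sub (hc1.intervalIntegrable _ _)
      (Continuous.intervalIntegrable (by fun_prop) _ _), integral_sum_mulVec_expVec,
      intervalIntegral.integral_const_mul]
    field_simp
  rw [h1, norm_mul]
  have h4 : ‖∫ t in (-Real.pi)..Real.pi,
        ∑ i, (((A ^ (p + 1)).mulVec (expVec n t)) i - fourierSymbol a t ^ (p + 1) * expVec n t i)
          * star (expVec n t i)‖ ≤ ((p + 1) * M ^ p * η) * |Real.pi - -Real.pi| := by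
    refine intervalIntegral.norm_integral_le_of_norm_le_const fun t _ => ?_
    calc _ ≤ ∑ i, ‖((A ^ (p + 1)).mulVec (expVec n t)) i
            - fourierSymbol a t ^ (p + 1) * expVec n t i‖ := by
          refine (norm_sum_le _ _).trans_eq (Finset.sum_congr rfl fun i _ => ?_)
          rw [norm_mul, norm_star, norm_expVec, mul_one]
      _ ≤ _ := Matrix.sum_norm_pow_mulVec_sub_le hM hA _ ((norm_fourierSymbol_le a t).trans ha) p
      _ ≤ _ := by gcongr; exact hη t
  have hpos := Real.pi_pos
  have h5 : ‖1 / (2 * (Real.pi : ℂ))‖ = 1 / (2 * Real.pi) := by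
    simp [abs_of_pos hpos]
  rw [h5]
  rw [show |Real.pi - -Real.pi| = 2 * Real.pi by rw [abs_of_pos] <;> linarith] at h4
  calc _ ≤ 1 / (2 * Real.pi) * (((p + 1) * M ^ p * η) * (2 * Real.pi)) := by gcongr
    _ = _ := by field_simp

/-- One row of a Toeplitz comparison: the residual of `e_t` as an approximate eigenvector. -/
theorem norm_sum_sub_fourierSymbol_le {n r : ℕ} (c : Fin n → ℂ) (i : Fin n) (t : ℝ) :
    ‖∑ j, c j * expVec n t j - fourierSymbol a t * expVec n t i‖
      ≤ ∑ j : Fin n, ‖c j - a ((j : ℤ) - i)‖ + (∑' k, coeffTail a r k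
        + ((if (i : ℕ) < r then ‖a‖ else 0) + if n ≤ i + r then ‖a‖ else 0)) := by
  have hinj : Set.InjOn (fun j : Fin n => (j : ℤ) - i) (Finset.univ : Finset (Fin n)) := by
    intro j _ k _ h
    have : (j : ℤ) - i = (k : ℤ) - i := h
    exact Fin.ext (by omega)
  -- The coefficients visible in row i. If the row is far enough from both ends, the missing ones
  -- have |k| > r; otherwise the whole norm of `a` is paid.
  set S : Finset ℤ := Finset.univ.image fun j : Fin n => (j : ℤ) - i with hS
  have hmem (k : ℤ) : k ∈ S ↔ 0 ≤ k + i ∧ k + i < n := by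
    rw [hS, Finset.mem_image]
    constructor
    · rintro ⟨j, -, rfl⟩
      have := j.2
      omega
    · rintro ⟨h1, h2⟩
      exact ⟨⟨(k + i).toNat, by omega⟩, Finset.mem_univ _, by simp; omega⟩
  set f : ℤ → ℂ := fun k => a k * Complex.exp (Complex.I * k * t) with hf
  have hfn (k : ℤ) : ‖f k‖ = ‖a k‖ := by simp [hf, norm_exp_I_mul_int_mul]
  have h1 : HasSum (fun k => f k - if k ∈ S then f k else 0) (fourierSymbol a t - ∑ k ∈ S, f k) := by
    have h := (summable_fourierSymbol a t).hasSum.sub (hasSum_sum_of_ne_finset_zero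
      (f := fun k => if k ∈ S then f k else 0) fun k hk => if_neg hk)
    rwa [Finset.sum_congr rfl fun k hk => if_pos hk] at h
  have h2 : ‖fourierSymbol a t - ∑ k ∈ S, f k‖ ≤ ∑' k, coeffTail a r k
        + ((if (i : ℕ) < r then ‖a‖ else 0) + if n ≤ i + r then ‖a‖ else 0) := by
    rw [← h1.tsum_eq]
    have hT : 0 ≤ ∑' k, coeffTail a r k := tsum_nonneg (coeffTail_nonneg a r)
    by_cases hi : (i : ℕ) < r ∨ n ≤ i + r
    · have h3 : ‖∑' k, (f k - if k ∈ S then f k else 0)‖ ≤ ‖a‖ := by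
        refine tsum_of_norm_bounded (lp_one_hasSum_norm a) fun k => ?_
        split_ifs <;> simp [hfn]
      have := norm_nonneg a
      split_ifs <;> first | linarith | omega
    · push Not at hi
      rw [if_neg (by omega), if_neg (by omega), add_zero, add_zero]
      refine tsum_of_norm_bounded (summable_coeffTail a r).hasSum fun k => ?_
      by_cases hk : k ∈ S
      · simp [hk, coeffTail_nonneg]
      · have : k ∉ Finset.Icc (-(r : ℤ)) r := by
          rw [Finset.mem_Icc]
          rw [hmem] at hk
          omega
        rw [coeffTail, if_neg this, if_neg hk, sub_zero, hfn]
  have h3 : ∑ j, c j * expVec n t j - fourierSymbol a t * expVec n t i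
      = ∑ j : Fin n, (c j - a ((j : ℤ) - i)) * expVec n t j
        - (fourierSymbol a t - ∑ k ∈ S, f k) * expVec n t i := by
    rw [hS, Finset.sum_image hinj, sub_mul (fourierSymbol a t), Finset.sum_mul]
    have (j : Fin n) : f ((j : ℤ) - i) * expVec n t i = a ((j : ℤ) - i) * expVec n t j := by
      simp only [hf, expVec, mul_assoc, ← Complex.exp_add]
      congr 2
      push_cast
      ring
    simp only [this, sub_mul, Finset.sum_sub_distrib]
    ring
  rw [h3]
  refine (norm_sub_le _ _).trans (add_le_add ?_ ?_)
  · refine (norm_sum_le _ _).trans_eq (Finset.sum_congr rfl fun j _ => ?_)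
    rw [norm_mul, norm_expVec, mul_one]
  · rwa [norm_mul, norm_expVec, mul_one]

theorem sum_norm_mulVec_expVec_sub_le {n : ℕ} (r : ℕ) (A : Matrix (Fin n) (Fin n) ℂ) (t : ℝ) :
    ∑ i, ‖(A.mulVec (expVec n t)) i - fourierSymbol a t * expVec n t i‖
      ≤ ∑ i : Fin n, ∑ j : Fin n, ‖A i j - a ((j : ℤ) - i)‖
        + (n * ∑' k, coeffTail a r k + 2 * r * ‖a‖) := by
  refine (Finset.sum_le_sum fun i _ => norm_sum_sub_fourierSymbol_le a (r := r) (A i) i t).trans ?_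
  rw [Finset.sum_add_distrib, Finset.sum_add_distrib, Finset.sum_add_distrib]
  have h1 : ∑ i : Fin n, (if (i : ℕ) < r then ‖a‖ else 0) ≤ r * ‖a‖ := by
    rw [Fin.sum_univ_eq_sum_range (fun i => if i < r then ‖a‖ else 0), ← Finset.sum_filter,
      Finset.sum_const, nsmul_eq_mul]
    gcongr
    refine (Finset.card_le_card (t := Finset.range r) fun i hi => ?_).trans_eq
      (Finset.card_range r)
    simp at hi ⊢
    omega
  have h2 : ∑ i : Fin n, (if n ≤ (i : ℕ) + r then ‖a‖ else 0) ≤ r * ‖a‖ := by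
    rw [Fin.sum_univ_eq_sum_range (fun i => if n ≤ i + r then ‖a‖ else 0), ← Finset.sum_filter,
      Finset.sum_const, nsmul_eq_mul]
    gcongr
    refine (Finset.card_le_card (t := Finset.Ico (n - r) n) fun i hi => ?_).trans
      (by rw [Nat.card_Ico]; omega)
    simp at hi ⊢
    omega
  simp only [Finset.sum_const, Finset.card_univ, Fintype.card_fin, nsmul_eq_mul]
  linarith

end Symbol

/-! ### Entries arranged along diagonals. -/

section Diagonals

variable {n : ℕ} (A : Matrix (Fin n) (Fin n) ℂ)

theorem diagEntry_sub_min (i j : Fin n) :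
    diagEntry A ((j : ℤ) - i) (min (i : ℕ) j) = A i j := by
  have h1 : min (i : ℕ) j + (-((j : ℤ) - i)).toNat = i := by omega
  have h2 : min (i : ℕ) j + ((j : ℤ) - i).toNat = j := by omega
  rw [diagEntry, dif_pos ⟨by omega, by omega⟩]
  congr 1 <;> exact Fin.ext (by assumption)

theorem diagEntry_eq_zero {k : ℤ} {j : ℕ} (h : n ≤ j + k.natAbs) : diagEntry A k j = 0 :=
  dif_neg (by omega)

/-- The upper cutoff in `diagSeq` removes nothing, since those positions lie outside the matrix;
only the lower cutoff loses entries. -/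
theorem diagSeq_eq_diagEntry {k : ℤ} {j : ℕ} (h : -(j : ℤ) ≤ k) :
    diagSeq A j k = diagEntry A k j := by
  rw [diagSeq]
  split_ifs with hk
  · rfl
  · exact (diagEntry_eq_zero A (by omega)).symm

theorem norm_diagSeq_le (k : ℤ) (j : ℕ) : ‖diagSeq A j k‖ ≤ ‖diagEntry A k j‖ := by
  rw [diagSeq]; split_ifs <;> simp

theorem norm_diagEntry_le_sup (k : ℤ) (j : ℕ) :
    ‖diagEntry A k j‖ ≤ (((Finset.range n).sup fun j => ‖diagEntry A k j‖₊ : NNReal) : ℝ) := by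
  by_cases hj : j < n
  · exact_mod_cast Finset.le_sup (f := fun j => ‖diagEntry A k j‖₊) (Finset.mem_range.2 hj)
  · rw [diagEntry_eq_zero A (by omega), norm_zero]
    positivity

/-- Rows, columns and diagonal vectors all pick at most one entry from each diagonal, so this one
bound serves all three. -/
theorem sum_norm_diagEntry_le_diagMaxSum (s : Finset ℤ) (m : ℤ → ℕ) :
    ∑ k ∈ s, ‖diagEntry A k (m k)‖ ≤ diagMaxSum A := by
  classical
  calc ∑ k ∈ s, ‖diagEntry A k (m k)‖
      ≤ ∑ k ∈ s ∪ Finset.Icc (-(n : ℤ)) n, ‖diagEntry A k (m k)‖ :=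
        Finset.sum_le_sum_of_subset_of_nonneg Finset.subset_union_left fun _ _ _ => norm_nonneg _
    _ = ∑ k ∈ Finset.Icc (-(n : ℤ)) n, ‖diagEntry A k (m k)‖ := by
        refine (Finset.sum_subset Finset.subset_union_right fun k _ hk => ?_).symm
        rw [Finset.mem_Icc] at hk
        rw [diagEntry_eq_zero A (by omega), norm_zero]
    _ ≤ _ := Finset.sum_le_sum fun k _ => norm_diagEntry_le_sup A k (m k)

theorem sum_row_norm_le_diagMaxSum (i : Fin n) : ∑ j, ‖A i j‖ ≤ diagMaxSum A := by
  have hinj : Set.InjOn (fun j : Fin n => (j : ℤ) - i) (Finset.univ : Finset (Fin n)) := by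
    intro j _ k _ h
    have : (j : ℤ) - i = (k : ℤ) - i := h
    exact Fin.ext (by omega)
  have h := sum_norm_diagEntry_le_diagMaxSum A (Finset.univ.image fun j : Fin n => (j : ℤ) - i)
    fun k => min (i : ℕ) (k + i).toNat
  rw [Finset.sum_image hinj] at h
  simpa [diagEntry_sub_min] using h

theorem sum_col_norm_le_diagMaxSum (j : Fin n) : ∑ i, ‖A i j‖ ≤ diagMaxSum A := by
  have hinj : Set.InjOn (fun i : Fin n => (j : ℤ) - i) (Finset.univ : Finset (Fin n)) := by
    intro i _ k _ h
    have : (j : ℤ) - i = (j : ℤ) - k := h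
    exact Fin.ext (by omega)
  have h := sum_norm_diagEntry_le_diagMaxSum A (Finset.univ.image fun i : Fin n => (j : ℤ) - i)
    fun k => min (j - k : ℤ).toNat (j : ℕ)
  rw [Finset.sum_image hinj] at h
  simpa [diagEntry_sub_min] using h

theorem summable_norm_diagEntry (j : ℕ) : Summable fun k => ‖diagEntry A k j‖ :=
  summable_of_sum_le (fun _ => norm_nonneg _)
    fun s => sum_norm_diagEntry_le_diagMaxSum A s fun _ => j

theorem tsum_norm_diagEntry_le (j : ℕ) : ∑' k, ‖diagEntry A k j‖ ≤ diagMaxSum A :=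
  (summable_norm_diagEntry A j).tsum_le_of_sum_le
    fun s => sum_norm_diagEntry_le_diagMaxSum A s fun _ => j

theorem norm_diagVec_le (j : ℕ) : ‖diagVec A j‖ ≤ diagMaxSum A := by
  rw [← (lp_one_hasSum_norm (diagVec A j)).tsum_eq]
  exact ((lp_one_hasSum_norm (diagVec A j)).summable.tsum_le_tsum (norm_diagSeq_le A · j)
    (summable_norm_diagEntry A j)).trans (tsum_norm_diagEntry_le A j)

/-- Summation of matrix entries along the diagonals. -/
theorem sum_norm_le_sum_of_diag (X : Fin n → Fin n → ℂ) (g : ℕ → ℤ → ℝ) (c : ℕ → ℝ)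
    (hg : ∀ m k, 0 ≤ g m k) (hs : ∀ m, Summable (g m)) (hc : ∀ m, ∑' k, g m k ≤ c m)
    (hX : ∀ i j : Fin n, ‖X i j‖ ≤ g (min (i : ℕ) j) ((j : ℤ) - i)) :
    ∑ i, ∑ j, ‖X i j‖ ≤ ∑ m ∈ Finset.range n, c m := by
  have h0 : ∑ i, ∑ j, ‖X i j‖ = ∑ x : Fin n × Fin n, ‖X x.1 x.2‖ :=
    (Fintype.sum_prod_type' (f := fun i j => ‖X i j‖)).symm
  have hmaps (x : Fin n × Fin n) (_ : x ∈ (Finset.univ : Finset (Fin n × Fin n))) :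
      min (x.1 : ℕ) x.2 ∈ Finset.range n := by
    rw [Finset.mem_range]; omega
  rw [h0, ← Finset.sum_fiberwise_of_maps_to hmaps]
  refine Finset.sum_le_sum fun m _ => ?_
  -- The hook of entries at position m of their diagonals; it meets each diagonal at most once.
  set s := Finset.univ.filter fun x : Fin n × Fin n => min (x.1 : ℕ) x.2 = m with hs'
  have hmem (x : Fin n × Fin n) (hx : x ∈ s) : min (x.1 : ℕ) x.2 = m := (Finset.mem_filter.1 hx).2
  have hinj : Set.InjOn (fun x : Fin n × Fin n => ((x.2 : ℕ) : ℤ) - (x.1 : ℕ)) s := by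
    intro x hx y hy h
    have hx := hmem x hx
    have hy := hmem y hy
    have : ((x.2 : ℕ) : ℤ) - (x.1 : ℕ) = ((y.2 : ℕ) : ℤ) - (y.1 : ℕ) := h
    exact Prod.ext (Fin.ext (by omega)) (Fin.ext (by omega))
  calc ∑ x ∈ s, ‖X x.1 x.2‖ ≤ ∑ x ∈ s, g m (((x.2 : ℕ) : ℤ) - (x.1 : ℕ)) := by
        refine Finset.sum_le_sum fun x hx => ?_
        have := hX x.1 x.2
        rwa [hmem x hx] at this
    _ = ∑ k ∈ s.image (fun x : Fin n × Fin n => ((x.2 : ℕ) : ℤ) - (x.1 : ℕ)), g m k :=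
        (Finset.sum_image hinj).symm
    _ ≤ ∑' k, g m k := (hs m).sum_le_tsum _ fun k _ => hg m k
    _ ≤ c m := hc m

/-- Entry sums of matrices that are dominated, at most positions on the diagonals, by the distance
of `𝐚_m` to `a` plus a tail of `a`. -/
theorem sum_norm_le_of_diagVec (a : lp (fun _ : ℤ => ℂ) 1) (r K : ℕ) {δ M : ℝ}
    (hδ : 0 ≤ δ) (hr : ∑' k, coeffTail a r k ≤ δ) (hA : diagMaxSum A ≤ M) (ha : ‖a‖ ≤ M)
    (X : Fin n → Fin n → ℂ)
    (hX1 : ∀ i j : Fin n, K ≤ min (i : ℕ) j → ‖X i j‖ ≤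
      ‖diagSeq A (min (i : ℕ) j) ((j : ℤ) - i) - a ((j : ℤ) - i)‖
        + coeffTail a r ((j : ℤ) - i))
    (hX2 : ∀ i j : Fin n, ‖X i j‖ ≤ ‖A i j‖ + ‖a ((j : ℤ) - i)‖) :
    ∑ i, ∑ j, ‖X i j‖ ≤ 2 * δ * n + 2 * M *
      (K + ((Finset.range n).filter fun j : ℕ => δ < ‖diagVec A j - a‖).card) := by
  classical
  have hM : 0 ≤ M := (norm_nonneg a).trans ha
  have hsub (m : ℕ) : HasSum (fun k => ‖diagSeq A m k - a k‖) ‖diagVec A m - a‖ :=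
    lp_one_hasSum_norm (diagVec A m - a)
  refine (sum_norm_le_sum_of_diag X
    -- A good position costs δ for the distance and δ for the tail. The others, at most K plus the
    -- number of exceptional ones, cost at most 2M each.
    (fun m k => if K ≤ m ∧ ‖diagVec A m - a‖ ≤ δ
      then ‖diagSeq A m k - a k‖ + coeffTail a r k else ‖diagEntry A k m‖ + ‖a k‖)
    (fun m => 2 * δ + ((if m < K then 2 * M else 0)
      + if δ < ‖diagVec A m - a‖ then 2 * M else 0)) ?_ ?_ ?_ ?_).trans ?_
  · intro m k
    have := coeffTail_nonneg a r k
    split_ifs <;> positivity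
  · intro m
    split_ifs
    · exact (hsub m).summable.add (summable_coeffTail a r)
    · exact (summable_norm_diagEntry A m).add (lp_one_hasSum_norm a).summable
  · intro m
    by_cases hm : K ≤ m ∧ ‖diagVec A m - a‖ ≤ δ
    · simp only [if_pos hm, if_neg hm.1.not_gt, if_neg hm.2.not_gt]
      rw [(hsub m).summable.tsum_add (summable_coeffTail a r), (hsub m).tsum_eq]
      linarith [hm.2]
    · simp only [if_neg hm]
      rw [(summable_norm_diagEntry A m).tsum_add (lp_one_hasSum_norm a).summable,
        (lp_one_hasSum_norm a).tsum_eq]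
      have h1 := tsum_norm_diagEntry_le A m
      rw [not_and_or, not_le, not_le] at hm
      split_ifs <;> first | linarith | tauto
  · intro i j
    beta_reduce
    split_ifs with h
    · exact hX1 i j h.1
    · rw [diagEntry_sub_min]
      exact hX2 i j
  · rw [Finset.sum_add_distrib, Finset.sum_add_distrib, ← Finset.sum_filter, ← Finset.sum_filter]
    simp only [Finset.sum_const, nsmul_eq_mul, Finset.card_range]
    have h1 : (((Finset.range n).filter fun m => m < K).card : ℝ) ≤ K := by
      exact_mod_cast (Finset.card_le_card (t := Finset.range K) fun i hi => by
        simp at hi ⊢; exact hi.2).trans_eq (Finset.card_range K)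
    have h2 := mul_le_mul_of_nonneg_right h1 (by positivity : 0 ≤ 2 * M)
    linarith

end Diagonals

/-! ### The trace estimate for a single matrix. -/

/-- Traces of powers of a single matrix compared with the mean of the powers of the symbol. -/
theorem norm_trace_pow_sub_le_of_diagVec {n : ℕ} (A : Matrix (Fin n) (Fin n) ℂ)
    (a : lp (fun _ : ℤ => ℂ) 1) (r p : ℕ) {δ M : ℝ}
    (hδ : 0 ≤ δ) (hr : ∑' k, coeffTail a r k ≤ δ) (hA : diagMaxSum A ≤ M) (ha : ‖a‖ ≤ M) :
    ‖(A ^ (p + 1)).trace - n * (1 / (2 * (Real.pi : ℂ)) *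
      ∫ t in (-Real.pi)..Real.pi, fourierSymbol a t ^ (p + 1))‖ ≤ (p + 1) * M ^ p *
      (5 * δ * n + 6 * M * ((p + 1) * r +
        ((Finset.range n).filter fun j : ℕ => δ < ‖diagVec A j - a‖).card)) := by
  have hM : 0 ≤ M := (norm_nonneg a).trans ha
  set bad := ((Finset.range n).filter fun j : ℕ => δ < ‖diagVec A j - a‖).card
  -- `B` drops the diagonals k > r, `C` also those k < -(p+1)r. At positions m ≥ (p+1)r every entry
  -- kept in `C` is visible to `diagSeq`.
  set B : Matrix (Fin n) (Fin n) ℂ := fun i j => if (r : ℤ) < (j : ℤ) - i then 0 else A i j with hB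
  set C : Matrix (Fin n) (Fin n) ℂ := fun i j => if (j : ℤ) - i < -((p + 1) * r : ℕ) then 0
    else B i j with hC
  have hBA (i j : Fin n) : ‖B i j‖ ≤ ‖A i j‖ := by simp only [hB]; split_ifs <;> simp
  have hCA (i j : Fin n) : ‖C i j‖ ≤ ‖A i j‖ := by
    refine le_trans ?_ (hBA i j)
    simp only [hC]; split_ifs <;> simp
  have hrK : r ≤ (p + 1) * r := Nat.le_mul_of_pos_left r (by omega)
  have hseq (i j : Fin n) (h1 : -((p + 1) * r : ℕ) ≤ (j : ℤ) - i)
      (h2 : (p + 1) * r ≤ min (i : ℕ) j) :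
      diagSeq A (min (i : ℕ) j) ((j : ℤ) - i) = A i j := by
    rw [diagSeq_eq_diagEntry A (by omega), diagEntry_sub_min]
  have htail (k : ℤ) (h : k < -((p + 1) * r : ℕ) ∨ (r : ℤ) < k) : coeffTail a r k = ‖a k‖ :=
    if_neg (by rw [Finset.mem_Icc]; omega)
  have hAB : ∑ i, ∑ j, ‖(A - B) i j‖ ≤ 2 * δ * n + 2 * M * (((p + 1) * r : ℕ) + bad) := by
    refine sum_norm_le_of_diagVec A a r _ hδ hr hA ha (A - B) (fun i j hij => ?_) fun i j => ?_
    · have h0 := coeffTail_nonneg a r ((j : ℤ) - i)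
      rw [Matrix.sub_apply]
      simp only [hB]
      split_ifs with h
      · rw [hseq i j (by omega) hij, htail _ (.inr h), sub_zero]
        linarith [norm_sub_norm_le (A i j) (a ((j : ℤ) - i))]
      · rw [sub_self, norm_zero]
        positivity
    · rw [Matrix.sub_apply]
      simp only [hB]
      split_ifs <;> simp
      positivity
  have hCT : ∑ i, ∑ j, ‖C i j - a ((j : ℤ) - i)‖
      ≤ 2 * δ * n + 2 * M * (((p + 1) * r : ℕ) + bad) := by
    refine sum_norm_le_of_diagVec A a r _ hδ hr hA ha (fun i j => C i j - a ((j : ℤ) - i))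
      (fun i j hij => ?_) fun i j => ?_
    · have h0 := coeffTail_nonneg a r ((j : ℤ) - i)
      simp only [hC, hB]
      split_ifs with h h'
      · rw [htail _ (.inl h), zero_sub, norm_neg]
        linarith [norm_nonneg (diagSeq A (min (i : ℕ) j) ((j : ℤ) - i) - a ((j : ℤ) - i))]
      · rw [htail _ (.inr h'), zero_sub, norm_neg]
        linarith [norm_nonneg (diagSeq A (min (i : ℕ) j) ((j : ℤ) - i) - a ((j : ℤ) - i))]
      · rw [hseq i j (by omega) hij]
        linarith
    · exact (norm_sub_le _ _).trans (by gcongr; exact hCA i j)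
  have hcol (j : Fin n) : ∑ i, ‖A i j‖ ≤ M := (sum_col_norm_le_diagMaxSum A j).trans hA
  have hrow (i : Fin n) : ∑ j, ‖A i j‖ ≤ M := (sum_row_norm_le_diagMaxSum A i).trans hA
  have h1 := Matrix.norm_trace_pow_sub_le hM hcol
    (fun i => (Finset.sum_le_sum fun j _ => hBA i j).trans (hrow i)) p
  have h2 : (B ^ (p + 1)).trace = (C ^ (p + 1)).trace := by
    refine Matrix.trace_pow_eq_of_band (r := r) (K := ((p + 1) * r : ℕ)) p
      (by push_cast; nlinarith) (fun i j h => if_pos h) (fun i j h => ?_) fun i j h => ?_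
    · simp only [hC, hB, if_pos h, ite_self]
    · simp only [hC]
      rw [if_neg (by omega)]
  have h3 := norm_trace_pow_sub_integral_le a hM (A := C)
    (fun j => (Finset.sum_le_sum fun i _ => hCA i j).trans (hcol j)) ha
    (fun t => (sum_norm_mulVec_expVec_sub_le a r C t).trans (add_le_add_left hCT _)) p
  rw [← h2] at h3
  have h4 : (n : ℝ) * ∑' k, coeffTail a r k + 2 * r * ‖a‖ ≤ n * δ + 2 * M * ((p + 1) * r) := by
    have : (r : ℝ) ≤ (p + 1) * r := by exact_mod_cast hrK
    have h5 : (r : ℝ) * ‖a‖ ≤ ((p + 1) * r) * M := by gcongr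
    have h6 : (n : ℝ) * ∑' k, coeffTail a r k ≤ n * δ := by gcongr
    linarith
  have hb : 0 ≤ M * bad := by positivity
  push_cast at hAB h3
  -- The 5δn is 2δn from A - B, 2δn from C against Toeplitz, δn from the tail; each source adds at
  -- most 2M per exceptional position, whence 6M.
  calc _ ≤ _ := norm_sub_le_norm_sub_add_norm_sub _ (B ^ (p + 1)).trace _
    _ ≤ _ := add_le_add h1 h3
    _ = (p + 1) * M ^ p * (∑ i, ∑ j, ‖(A - B) i j‖ + (2 * δ * n + 2 * M * ((p + 1) * r + bad)
        + (n * ∑' k, coeffTail a r k + 2 * r * ‖a‖))) := by ring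
    _ ≤ _ := mul_le_mul_of_nonneg_left (by linarith) (by positivity)

/-! ### Polynomial approximation and passage from moments to test functions. -/

open Polynomial in
/-- Functions in the disk algebra are uniform limits of polynomials. -/
theorem exists_polynomial_near_of_analyticOnNhd_ball {M : ℝ} (hM : 0 ≤ M) {φ : ℂ → ℂ}
    (hc : ContinuousOn φ (Metric.closedBall 0 M)) (ha : AnalyticOnNhd ℂ φ (Metric.ball 0 M))
    {ε : ℝ} (hε : 0 < ε) :
    ∃ q : ℂ[X], ∀ z ∈ Metric.closedBall (0 : ℂ) M, ‖q.eval z - φ z‖ ≤ ε := by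
  rcases hM.eq_or_lt with rfl | hM
  · refine ⟨C (φ 0), fun z hz => ?_⟩
    have : z = 0 := by simpa using hz
    subst this
    simp [hε.le]
  obtain ⟨d, hd, hφ⟩ := Metric.uniformContinuousOn_iff.1
    ((isCompact_closedBall (0 : ℂ) M).uniformContinuousOn_of_continuous hc) (ε / 2) (half_pos hε)
  -- The dilate φ(sz) is uniformly close to φ and analytic past the closed disk, so its Taylor
  -- polynomials converge uniformly there.
  obtain ⟨s, hs0, hs1, hsd⟩ : ∃ s : ℝ, 0 < s ∧ s < 1 ∧ (1 - s) * M < d := by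
    refine ⟨max (1 / 2) (1 - d / (2 * M)), by positivity, ?_, ?_⟩
    · have : 0 < d / (2 * M) := by positivity
      exact max_lt (by norm_num) (by linarith)
    · have h1 : 1 - max (1 / 2) (1 - d / (2 * M)) ≤ d / (2 * M) := by
        linarith [le_max_right (1 / 2) (1 - d / (2 * M))]
      calc _ ≤ d / (2 * M) * M := by gcongr
        _ = d / 2 := by field_simp
        _ < d := by linarith
  obtain ⟨R, hMR, hRM⟩ : ∃ R : ℝ, M < R ∧ s * R < M :=
    ⟨(M + M / s) / 2, by
      have : M < M / s := by rw [lt_div_iff₀ hs0]; nlinarith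
      linarith, by
      have : s * ((M + M / s) / 2) = (s * M + M) / 2 := by field_simp
      rw [this]; nlinarith⟩
  have hR : 0 < R := hM.trans hMR
  have hdiff : DifferentiableOn ℂ (fun z => φ (s * z)) (Metric.closedBall 0 R) := by
    refine ha.differentiableOn.comp (by fun_prop) fun z hz => ?_
    rw [mem_closedBall_zero_iff] at hz
    rw [mem_ball_zero_iff, norm_mul, Complex.norm_real, Real.norm_of_nonneg hs0.le]
    exact (by gcongr : s * ‖z‖ ≤ s * R).trans_lt hRM
  lift R to NNReal using hR.le
  have hps := hdiff.hasFPowerSeriesOnBall (by exact_mod_cast hR)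
  obtain ⟨R', hR'1, hR'2⟩ := exists_between hMR
  lift R' to NNReal using (hM.trans hR'1).le
  obtain ⟨N, hN⟩ := ((Metric.tendstoUniformlyOn_iff.1 (hps.tendstoUniformlyOn (r' := R')
    (by exact_mod_cast hR'2))) (ε / 2) (half_pos hε)).exists
  refine ⟨∑ k ∈ Finset.range N, C ((cauchyPowerSeries (fun z => φ (s * z)) 0 R).coeff k) * X ^ k,
    fun z hz => ?_⟩
  have hz' := mem_closedBall_zero_iff.1 hz
  have h1 := hN z (mem_ball_zero_iff.2 (hz'.trans_lt hR'1))
  have h2 := hφ (s * z) (by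
    rw [mem_closedBall_zero_iff, norm_mul, Complex.norm_real, Real.norm_of_nonneg hs0.le]
    nlinarith [norm_nonneg z]) z hz (by
    rw [dist_eq_norm, show (s : ℂ) * z - z = -((1 - s : ℝ) * z) by push_cast; ring, norm_neg,
      norm_mul, Complex.norm_real, Real.norm_of_nonneg (by linarith)]
    exact (by gcongr : (1 - s) * ‖z‖ ≤ (1 - s) * M).trans_lt hsd)
  rw [zero_add] at h1
  have h3 : (∑ k ∈ Finset.range N,
      C ((cauchyPowerSeries (fun z => φ (s * z)) 0 R).coeff k) * X ^ k).eval z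
      = (cauchyPowerSeries (fun z => φ (s * z)) 0 R).partialSum N z := by
    rw [FormalMultilinearSeries.partialSum, eval_finsetSum]
    refine Finset.sum_congr rfl fun k _ => ?_
    rw [FormalMultilinearSeries.apply_eq_pow_smul_coeff, smul_eq_mul]
    rw [eval_mul, eval_C, eval_pow, eval_X, mul_comm]
  rw [h3, ← dist_eq_norm]
  rw [dist_comm] at h1
  linarith [dist_triangle ((cauchyPowerSeries (fun z => φ (s * z)) 0 R).partialSum N z)
    (φ (s * z)) (φ z)]

open Polynomial in
/-- The Weierstrass theorem for complex-valued functions on a real interval. -/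
theorem exists_complex_polynomial_near_of_continuousOn {x y : ℝ} {φ : ℝ → ℂ}
    (hc : ContinuousOn φ (Set.Icc x y)) {ε : ℝ} (hε : 0 < ε) :
    ∃ q : ℂ[X], ∀ t ∈ Set.Icc x y, ‖q.eval (t : ℂ) - φ t‖ ≤ ε := by
  obtain ⟨u, hu⟩ := exists_polynomial_near_of_continuousOn x y (fun t => (φ t).re)
    (Complex.continuous_re.comp_continuousOn hc) (ε / 2) (half_pos hε)
  obtain ⟨v, hv⟩ := exists_polynomial_near_of_continuousOn x y (fun t => (φ t).im)
    (Complex.continuous_im.comp_continuousOn hc) (ε / 2) (half_pos hε)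
  refine ⟨u.map Complex.ofRealHom + C Complex.I * v.map Complex.ofRealHom, fun t ht => ?_⟩
  have hev (w : ℝ[X]) : (w.map Complex.ofRealHom).eval (t : ℂ) = (w.eval t : ℝ) :=
    eval_map_apply Complex.ofRealHom t
  have h1 := Complex.norm_le_abs_re_add_abs_im
    ((u.map Complex.ofRealHom + C Complex.I * v.map Complex.ofRealHom).eval (t : ℂ) - φ t)
  simp only [eval_add, eval_mul, eval_C, hev] at h1 ⊢
  simp at h1
  linarith [hu t ht, hv t ht]

open Polynomial in
/-- Equidistribution of finite multisets with respect to a continuous curve, tested on powers,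
extends to all functions that are uniformly approximable by polynomials. -/
theorem tendsto_mean_of_tendsto_pow {s : ℕ → Multiset ℂ} (hs : ∀ n, Multiset.card (s n) = n)
    {f : ℝ → ℂ} (hf : Continuous f) {S : Set ℂ} (hsS : ∀ n, ∀ z ∈ s n, z ∈ S) (hfS : ∀ t, f t ∈ S)
    (hpow : ∀ p : ℕ, Filter.Tendsto (fun n : ℕ => (1 / (n : ℂ)) * ((s n).map (· ^ p)).sum)
      Filter.atTop (nhds ((1 / (2 * (Real.pi : ℂ))) * ∫ t in (-Real.pi)..Real.pi, f t ^ p)))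
    {φ : ℂ → ℂ} (hφ : ContinuousOn φ S)
    (happ : ∀ ε : ℝ, 0 < ε → ∃ q : ℂ[X], ∀ z ∈ S, ‖q.eval z - φ z‖ ≤ ε) :
    Filter.Tendsto (fun n : ℕ => (1 / (n : ℂ)) * ((s n).map φ).sum)
      Filter.atTop (nhds ((1 / (2 * (Real.pi : ℂ))) * ∫ t in (-Real.pi)..Real.pi, φ (f t))) := by
  have hpoly (q : ℂ[X]) : Filter.Tendsto (fun n : ℕ => (1 / (n : ℂ)) * ((s n).map q.eval).sum)
      Filter.atTop
      (nhds ((1 / (2 * (Real.pi : ℂ))) * ∫ t in (-Real.pi)..Real.pi, q.eval (f t))) := by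
    induction q using Polynomial.induction_on' with
    | add q₁ q₂ h₁ h₂ =>
      have h := h₁.add h₂
      simp only [eval_add, Multiset.sum_map_add, mul_add]
      rwa [intervalIntegral.integral_add (Continuous.intervalIntegrable (by fun_prop) _ _)
        (Continuous.intervalIntegrable (by fun_prop) _ _), mul_add]
    | monomial p c =>
      have h := (hpow p).const_mul c
      simp only [eval_monomial, Multiset.sum_map_mul_left, intervalIntegral.integral_const_mul]
      simpa only [mul_left_comm c] using h
  have hcont : Continuous fun t => φ (f t) := hφ.comp_continuous hf hfS
  rw [Metric.tendsto_atTop]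
  intro ε hε
  obtain ⟨q, hq⟩ := happ (ε / 4) (by positivity)
  obtain ⟨N, hN⟩ := Metric.tendsto_atTop.1 (hpoly q) (ε / 4) (by positivity)
  refine ⟨max N 1, fun n hn => ?_⟩
  have hn0 : (0 : ℝ) < n := by
    have := (le_max_right N 1).trans hn
    exact_mod_cast this
  have h1 : ‖(1 / (n : ℂ)) * ((s n).map φ).sum - (1 / (n : ℂ)) * ((s n).map q.eval).sum‖
      ≤ ε / 4 := by
    rw [← mul_sub, ← Multiset.sum_map_sub, norm_mul]
    have h2 : ‖((s n).map fun z => φ z - q.eval z).sum‖ ≤ n * (ε / 4) := by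
      refine (norm_multiset_sum_le _).trans ?_
      rw [Multiset.map_map]
      refine (Multiset.sum_le_card_nsmul _ (ε / 4) fun x hx => ?_).trans_eq ?_
      · obtain ⟨z, hz, rfl⟩ := Multiset.mem_map.1 hx
        rw [Function.comp_apply, norm_sub_rev]
        exact hq z (hsS n z hz)
      · rw [Multiset.card_map, hs, nsmul_eq_mul]
    calc _ ≤ ‖1 / (n : ℂ)‖ * (n * (ε / 4)) := by gcongr
      _ = ε / 4 := by simp; field_simp
  have h3 : ‖(1 / (2 * (Real.pi : ℂ))) * (∫ t in (-Real.pi)..Real.pi, q.eval (f t)) -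
      (1 / (2 * (Real.pi : ℂ))) * ∫ t in (-Real.pi)..Real.pi, φ (f t)‖ ≤ ε / 4 := by
    have hpos := Real.pi_pos
    rw [← mul_sub, ← intervalIntegral.integral_sub
      (Continuous.intervalIntegrable (by fun_prop) _ _) (hcont.intervalIntegrable _ _), norm_mul]
    have h4 := intervalIntegral.norm_integral_le_of_norm_le_const (a := -Real.pi) (b := Real.pi)
      (f := fun t => q.eval (f t) - φ (f t)) (C := ε / 4) fun t _ => hq _ (hfS t)
    rw [show |Real.pi - -Real.pi| = 2 * Real.pi by rw [abs_of_pos] <;> linarith] at h4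
    have h5 : ‖1 / (2 * (Real.pi : ℂ))‖ = 1 / (2 * Real.pi) := by
      simp [abs_of_pos hpos]
    rw [h5]
    calc _ ≤ 1 / (2 * Real.pi) * (ε / 4 * (2 * Real.pi)) := by gcongr
      _ = _ := by field_simp
  have h6 := hN n ((le_max_left _ _).trans hn)
  rw [← dist_eq_norm] at h1 h3
  have h7 := dist_triangle4 ((1 / (n : ℂ)) * ((s n).map φ).sum)
    ((1 / (n : ℂ)) * ((s n).map q.eval).sum)
    ((1 / (2 * (Real.pi : ℂ))) * ∫ t in (-Real.pi)..Real.pi, q.eval (f t))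
    ((1 / (2 * (Real.pi : ℂ))) * ∫ t in (-Real.pi)..Real.pi, φ (f t))
  linarith

/-! ### Asymptotics along the sequence. -/

section Sequence

variable {A : (n : ℕ) → Matrix (Fin n) (Fin n) ℂ} {a : lp (fun _ : ℤ => ℂ) 1}

theorem eventually_card_add_lt {b : ℕ → ℕ}
    (h : (fun n : ℕ => (b n : ℝ)) =o[Filter.atTop] (fun n : ℕ => (n : ℝ))) (c : ℕ) :
    ∀ᶠ n in Filter.atTop, b n + c < n := by
  filter_upwards [h.def (c := 1 / 2) (by norm_num), Filter.eventually_gt_atTop (2 * c)]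
    with n h1 h2
  simp only [Real.norm_natCast] at h1
  have h3 : ((2 * c : ℕ) : ℝ) < n := by exact_mod_cast h2
  push_cast at h3
  have : (b n : ℝ) + c < n := by linarith
  exact_mod_cast this

/-- For large `n` there are positions far from both ends at which `𝐚_m(n)` is close to `a`. -/
theorem eventually_exists_norm_diagVec_sub_le
    (hconv : ∀ ε : ℝ, 0 < ε →
      (fun n : ℕ => (((Finset.range n).filter fun j : ℕ => ε < ‖diagVec (A n) j - a‖).card : ℝ))
        =o[Filter.atTop] (fun n : ℕ => (n : ℝ))) {ε : ℝ} (hε : 0 < ε) (c : ℕ) :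
    ∀ᶠ n in Filter.atTop, ∃ m, c ≤ m ∧ m + c < n ∧ ‖diagVec (A n) m - a‖ ≤ ε := by
  filter_upwards [eventually_card_add_lt (hconv ε hε) (2 * c)] with n hn
  by_contra! h
  have h1 : Finset.Ico c (n - c) ⊆
      (Finset.range n).filter fun j : ℕ => ε < ‖diagVec (A n) j - a‖ := by
    intro m hm
    rw [Finset.mem_Ico] at hm
    rw [Finset.mem_filter, Finset.mem_range]
    exact ⟨by omega, h m hm.1 (by omega)⟩
  have h2 := Finset.card_le_card h1
  rw [Nat.card_Ico] at h2
  omega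

/-- Some diagonal vector, of norm at most M, is arbitrarily close to `a`. -/
theorem norm_le_of_forall_diagMaxSum_le {M : ℝ} (hM : ∀ n, diagMaxSum (A n) ≤ M)
    (hconv : ∀ ε : ℝ, 0 < ε →
      (fun n : ℕ => (((Finset.range n).filter fun j : ℕ => ε < ‖diagVec (A n) j - a‖).card : ℝ))
        =o[Filter.atTop] (fun n : ℕ => (n : ℝ))) : ‖a‖ ≤ M := by
  refine le_of_forall_pos_le_add fun ε hε => ?_
  obtain ⟨n, m, -, -, h⟩ := (eventually_exists_norm_diagVec_sub_le hconv hε 0).exists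
  have h1 := (norm_diagVec_le (A n) m).trans (hM n)
  rw [norm_sub_rev] at h
  linarith [norm_sub_norm_le a (diagVec (A n) m)]

theorem diagEntry_neg_of_isHermitian {n : ℕ} {B : Matrix (Fin n) (Fin n) ℂ} (hB : B.IsHermitian)
    (k : ℤ) (j : ℕ) : diagEntry B (-k) j = star (diagEntry B k j) := by
  simp only [diagEntry, neg_neg]
  split_ifs with h1 h2 h2
  · exact (hB.apply _ _).symm
  · exact absurd h1.symm h2
  · exact absurd h2.symm h1
  · simp

theorem apply_neg_of_isHermitian (hA : ∀ n, (A n).IsHermitian)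
    (hconv : ∀ ε : ℝ, 0 < ε →
      (fun n : ℕ => (((Finset.range n).filter fun j : ℕ => ε < ‖diagVec (A n) j - a‖).card : ℝ))
        =o[Filter.atTop] (fun n : ℕ => (n : ℝ))) (k : ℤ) : a (-k) = star (a k) := by
  refine eq_of_forall_dist_le fun ε hε => ?_
  obtain ⟨n, m, h1, h2, h3⟩ :=
    -- Taking m ≥ |k| makes both coordinates k and -k visible in the vector.
    (eventually_exists_norm_diagVec_sub_le hconv (half_pos hε) k.natAbs).exists
  have hcoord (l : ℤ) (hl : -(m : ℤ) ≤ l) : ‖diagEntry (A n) l m - a l‖ ≤ ε / 2 := by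
    rw [← diagSeq_eq_diagEntry (A n) hl]
    exact (lp.norm_apply_le_norm one_ne_zero (diagVec (A n) m - a) l).trans h3
  have h4 := hcoord (-k) (by omega)
  have h5 := hcoord k (by omega)
  rw [diagEntry_neg_of_isHermitian (hA n), ← dist_eq_norm] at h4
  rw [← norm_star, star_sub, ← dist_eq_norm] at h5
  rw [dist_comm] at h4
  linarith [dist_triangle (a (-k)) (star (diagEntry (A n) k m)) (star (a k))]

theorem tendsto_mean_pow_roots {M : ℝ} (hM : ∀ n, diagMaxSum (A n) ≤ M)
    (hconv : ∀ ε : ℝ, 0 < ε →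
      (fun n : ℕ => (((Finset.range n).filter fun j : ℕ => ε < ‖diagVec (A n) j - a‖).card : ℝ))
        =o[Filter.atTop] (fun n : ℕ => (n : ℝ))) (p : ℕ) :
    Filter.Tendsto (fun n : ℕ => (1 / (n : ℂ)) * ((A n).charpoly.roots.map (· ^ p)).sum)
      Filter.atTop (nhds ((1 / (2 * (Real.pi : ℂ))) *
        ∫ t in (-Real.pi)..Real.pi, fourierSymbol a t ^ p)) := by
  rcases p with - | p
  · refine tendsto_const_nhds.congr' ?_
    filter_upwards [Filter.eventually_gt_atTop 0] with n hn
    have h1 : (n : ℂ) ≠ 0 := by exact_mod_cast hn.ne'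
    have h2 : (Real.pi : ℂ) ≠ 0 := by simp [Real.pi_ne_zero]
    simp [Matrix.card_roots_charpoly]
    field_simp
    ring
  have ha := norm_le_of_forall_diagMaxSum_le hM hconv
  have hM0 : 0 ≤ M := (norm_nonneg a).trans ha
  set c : ℝ := (p + 1) * M ^ p with hc
  have hc0 : 0 ≤ c := by positivity
  rw [Metric.tendsto_atTop']
  intro ε hε
  -- Makes c · 5δ ≤ ε/2; the +1 covers c = 0.
  set δ : ℝ := ε / (10 * (c + 1)) with hδ'
  have hδ : 0 < δ := by positivity
  obtain ⟨r, hr⟩ := exists_tsum_coeffTail_le a hδ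
  have hlim : Filter.Tendsto (fun n : ℕ => c * (6 * M * ((p + 1) * r +
      (((Finset.range n).filter fun j : ℕ => δ < ‖diagVec (A n) j - a‖).card : ℝ))) / n)
      Filter.atTop (nhds 0) := by
    have h1 : (fun _ : ℕ => ((p + 1) * r : ℝ)) =o[Filter.atTop] (fun n : ℕ => (n : ℝ)) :=
      Asymptotics.isLittleO_const_left.2 (.inr (by
        simpa [Function.comp_def] using tendsto_natCast_atTop_atTop (R := ℝ)))
    have h2 := ((h1.add (hconv δ hδ)).const_mul_left (6 * M)).const_mul_left c
    exact h2.tendsto_div_nhds_zero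
  obtain ⟨N, hN⟩ := Filter.eventually_atTop.1 (hlim.eventually (gt_mem_nhds (half_pos hε)))
  refine ⟨N, fun n hn => ?_⟩
  rcases Nat.eq_zero_or_pos n with rfl | hn0
  · omega
  have hn0 : (0 : ℝ) < n := by exact_mod_cast hn0
  have h1 := norm_trace_pow_sub_le_of_diagVec (A n) a r p hδ.le hr (hM n) ha
  have h2 := hN n hn.le
  rw [← hc] at h1
  have h3 : c * (5 * δ) ≤ ε / 2 := by
    rw [hδ']
    have : c * (5 * (ε / (10 * (c + 1)))) = ε / 2 * (c / (c + 1)) := by field_simp; ring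
    rw [this]
    exact mul_le_of_le_one_right (by positivity) ((div_le_one (by positivity)).2 (by linarith))
  have hnC : (n : ℂ) ≠ 0 := by exact_mod_cast hn0.ne'
  rw [← Matrix.trace_pow_eq_sum_roots_charpoly, dist_eq_norm]
  have h4 (x y : ℂ) : ‖1 / (n : ℂ) * x - y‖ = ‖x - n * y‖ / n := by
    rw [show 1 / (n : ℂ) * x - y = (x - n * y) / n by field_simp, norm_div, Complex.norm_natCast]
  rw [h4, div_lt_iff₀ hn0]
  rw [div_lt_iff₀ hn0] at h2
  have h5 := mul_le_mul_of_nonneg_right h3 hn0.le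
  linarith

end Sequence

theorem mainTheorem6
    (A : (n : ℕ) → Matrix (Fin n) (Fin n) ℂ)
    (hbdd : BddAbove (Set.range fun n : ℕ => diagMaxSum (A n)))
    (a : lp (fun _ : ℤ => ℂ) 1)
    (hconv : ∀ ε : ℝ, 0 < ε →
      (fun n : ℕ => (((Finset.range n).filter
          fun j : ℕ => ε < ‖diagVec (A n) j - a‖).card : ℝ))
        =o[Filter.atTop] (fun n : ℕ => (n : ℝ))) :
    -- the eigenvalues and the values of the symbol lie in the disk where `φ` is given
    (∀ n : ℕ, ∀ z ∈ (A n).charpoly.roots, ‖z‖ ≤ diagBound A) ∧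
    (∀ t : ℝ, ‖fourierSymbol a t‖ ≤ diagBound A) ∧
    -- the general case; eigenvalues are listed with algebraic multiplicity
    (∀ φ : ℂ → ℂ,
      ContinuousOn φ (Metric.closedBall 0 (diagBound A)) →
      AnalyticOnNhd ℂ φ (Metric.ball 0 (diagBound A)) →
      Filter.Tendsto
        (fun n : ℕ => (1 / (n : ℂ)) * ((A n).charpoly.roots.map φ).sum)
        Filter.atTop
        (nhds ((1 / (2 * (Real.pi : ℂ))) *
          ∫ t in (-Real.pi)..Real.pi, φ (fourierSymbol a t)))) ∧
    -- the Hermitian case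
    (∀ hA : ∀ n : ℕ, (A n).IsHermitian,
      (∀ t : ℝ, (fourierSymbol a t).im = 0) ∧
      ∀ φ : ℝ → ℂ, ContinuousOn φ (Set.Icc (-diagBound A) (diagBound A)) →
        Filter.Tendsto
          (fun n : ℕ => (1 / (n : ℂ)) * ∑ i, φ ((hA n).eigenvalues i))
          Filter.atTop
          (nhds ((1 / (2 * (Real.pi : ℂ))) *
            ∫ t in (-Real.pi)..Real.pi, φ (fourierSymbol a t).re))) := by
  have hM (n : ℕ) : diagMaxSum (A n) ≤ diagBound A := le_ciSup hbdd n
  have ha : ‖a‖ ≤ diagBound A := norm_le_of_forall_diagMaxSum_le hM hconv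
  have hroots (n : ℕ) : ∀ z ∈ (A n).charpoly.roots, ‖z‖ ≤ diagBound A := fun z hz =>
    Matrix.norm_le_of_mem_roots_charpoly
      (fun i => (sum_row_norm_le_diagMaxSum (A n) i).trans (hM n)) hz
  have hsym (t : ℝ) : ‖fourierSymbol a t‖ ≤ diagBound A := (norm_fourierSymbol_le a t).trans ha
  refine ⟨hroots, hsym, fun φ hφ hφ' => ?_, fun hA => ?_⟩
  · exact tendsto_mean_of_tendsto_pow (fun n => Matrix.card_roots_charpoly (A n))
      (continuous_fourierSymbol a) (fun n z hz => mem_closedBall_zero_iff.2 (hroots n z hz))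
      (fun t => mem_closedBall_zero_iff.2 (hsym t)) (tendsto_mean_pow_roots hM hconv) hφ
      fun ε hε => exists_polynomial_near_of_analyticOnNhd_ball ((norm_nonneg a).trans ha) hφ hφ' hε
  have him := fourierSymbol_im_eq_zero a (apply_neg_of_isHermitian hA hconv)
  refine ⟨him, fun φ hφ => ?_⟩
  have hre {z : ℂ} (hz : z ∈ {z : ℂ | ‖z‖ ≤ diagBound A ∧ z.im = 0}) :
      z.re ∈ Set.Icc (-diagBound A) (diagBound A) :=
    abs_le.1 ((Complex.abs_re_le_norm z).trans hz.1)
  have hmap (n : ℕ) : ((A n).charpoly.roots.map fun z => φ z.re).sum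
      = ∑ i, φ ((hA n).eigenvalues i) := by
    rw [(hA n).roots_charpoly_eq_eigenvalues, Multiset.map_map]
    rfl
  -- On the real part of the disk, φ ∘ re needs only Weierstrass approximation, with no analyticity.
  have h := tendsto_mean_of_tendsto_pow (fun n => Matrix.card_roots_charpoly (A n))
    (continuous_fourierSymbol a) (S := {z : ℂ | ‖z‖ ≤ diagBound A ∧ z.im = 0})
    (fun n z hz => ⟨hroots n z hz, by
      rw [(hA n).roots_charpoly_eq_eigenvalues] at hz
      obtain ⟨i, -, rfl⟩ := Multiset.mem_map.1 hz
      simp⟩) (fun t => ⟨hsym t, him t⟩)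
    (tendsto_mean_pow_roots hM hconv) (φ := fun z => φ z.re)
    (hφ.comp Complex.continuous_re.continuousOn fun z hz => hre hz) fun ε hε => by
      obtain ⟨q, hq⟩ := exists_complex_polynomial_near_of_continuousOn hφ hε
      refine ⟨q, fun z hz => ?_⟩
      have := hq z.re (hre hz)
      rwa [show ((z.re : ℝ) : ℂ) = z from Complex.ext rfl hz.2.symm] at this
  simpa only [hmap] using h
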